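/- Let $(X,\mathcal B,\mu)$ be a measure space and $T:X\to X$ a measurable map preserving $\mu$. For a measurable $f:X\to\mathbb R$ put $f_n(x)=\sum_{k=0}^{n-1}f(T^kx)$, $n\ge 0$. The cocycle $(f_n)$ is called recurrent on a set $E$ if $\liminf_{n\to\infty}|f_n(x)|<\infty$ for $\mu$-a.e. $x\in E$. Limits inferior are taken in $[-\infty,+\infty]$. Suppose, for (1) and (2), that $\mu$ is $\sigma$-finite and $T$ is conservative for $\mu$ (for every measurable $B$, for $\mu$-a.e. $x\in B$ there is $n\ge 1$ with $T^nx\in B$), and let $p:X\to\,]0,+\infty[$ be any measurable $\mu$-integrable function (for instance one with $0<p\le 1$ and $\int p\,d\mu=1$). (1) If $\varphi:X\to[0,+\infty[$ is measurable, then for $\mu$-a.e. $x$ the sum $\sum_{k=0}^\infty\varphi(T^kx)$ is either $0$ or $+\infty$, and $\liminf_n \varphi_n(x)/p_n(x)\in\,]0,+\infty]$ for $\mu$-a.e. $x$ in the set where $\sum_{k=0}^\infty\varphi(T^kx)\neq 0$. (2) For every measurable $\varphi:X\to\mathbb R$, $\liminf_n\varphi_n(x)/p_n(x)>0$ for $\mu$-a.e.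 $x$ in the set where $\varphi_n(x)\to+\infty$. Moreover the set $\{x:\lim_n\varphi_n(x)/p_n(x)=0\}$ is $T$-invariant modulo $\mu$-null sets, and the cocycle $(\varphi_n)$ is recurrent on it. (3) If $\mu$ is a probability measure, then for every measurable $\varphi:X\to\mathbb R$, $\liminf_n\frac1n\varphi_n(x)>0$ for $\mu$-a.e. $x$ in the set where $\varphi_n(x)\to+\infty$; moreover the set $\{x:\lim_n\frac1n\varphi_n(x)=0\}$ is $T$-invariant modulo $\mu$-null sets, and the cocycle $(\varphi_n)$ is recurrent on it. -/

import Mathlib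

open MeasureTheory Filter Topology
open scoped ENNReal

/-- The cocycle `φ_n = ∑_{k<n} φ ∘ T^k` (Mathlib's `birkhoffSum T φ n`) is recurrent on the set `E`:
`liminf_n |φ_n(x)| < ∞` for `μ`-almost every `x ∈ E`. -/
def CocycleRecurrentOn {X : Type*} [MeasurableSpace X] (T : X → X) (φ : X → ℝ) (μ : Measure X)
    (E : Set X) : Prop :=
  ∀ᵐ x ∂μ, x ∈ E → liminf (fun n : ℕ => ‖birkhoffSum T φ n x‖ₑ) atTop < ∞

/-- `liminf_n a_n` of a real sequence, as an element of `[-∞, +∞]`. -/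
noncomputable def extLiminf (a : ℕ → ℝ) : EReal :=
  liminf (fun n : ℕ => (a n : EReal)) atTop

/-- The set of points `x` at which `lim_n φ_n(x) / p_n(x)` exists and equals `0`. -/
def zeroRatioSet {X : Type*} (T : X → X) (φ p : X → ℝ) : Set X :=
  {x | Tendsto (fun n : ℕ => birkhoffSum T φ n x / birkhoffSum T p n x) atTop (𝓝 0)}

/-- The set of points `x` at which `lim_n φ_n(x) / n` exists and equals `0`. -/
def zeroMeanSet {X : Type*} (T : X → X) (φ : X → ℝ) : Set X :=
  {x | Tendsto (fun n : ℕ => birkhoffSum T φ n x / (n : ℝ)) atTop (𝓝 0)}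

/-! Everything rests on one comparison: for `φ ≥ 0`, almost every `x` whose orbit meets `{φ ≠ 0}`
has `φ_n(x) ≥ c(x) p_n(x)` eventually, with `c(x) > 0` (`ae_exists_const_mul_birkhoffSum_le`). After
replacing `φ` by `min φ p` it may be taken integrable. The set where `φ_n → ∞` but `p_n / φ_n` is
unbounded is invariant; Hopf's maximal inequality for `p - mφ` on it gives `m ∫ φ ≤ ∫ p` for all
`m`. Hence `φ` vanishes almost everywhere there, against divergence, and the set is null.

If `φ` is signed and `φ_n → +∞`, adding the coboundary of `F = inf_n φ_n` makes it nonnegative.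
Since `F ≤ 0`, the corrected sums are at most `φ_n - F(x)`, so their lower bound passes to `φ_n`.

For recurrence, `|φ_n(x)| → ∞` puts `x` in an escape set, which its orbit then visits at least `c
p_n` times before time `n`. Visits at least `N` apart have 1-separated cocycle values, so `max_{k<n}
|φ_k|` is at least of order `p_n`, against `φ_n = o(p_n)`. -/

/-! ### Real sequences -/

/-- A sequence eventually bounded below by a positive constant has positive liminf. -/
theorem extLiminf_pos {a : ℕ → ℝ} {c : ℝ} (hc : 0 < c) (h : ∀ᶠ n in atTop, c ≤ a n) :
    0 < extLiminf a := by
  have h1 : (0 : EReal) < (c : EReal) := by exact_mod_cast hc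
  refine h1.trans_le ?_
  refine le_liminf_of_le (by isBoundedDefault) ?_
  filter_upwards [h] with n hn
  exact_mod_cast hn

theorem frequently_atTop_succ {P : ℕ → Prop} :
    (∃ᶠ n in atTop, P (n + 1)) ↔ ∃ᶠ n in atTop, P n := by
  conv_rhs => rw [← map_add_atTop_eq_nat 1]
  exact frequently_map.symm

theorem bddBelow_range_of_tendsto_atTop {a : ℕ → ℝ} (h : Tendsto a atTop atTop) :
    BddBelow (Set.range a) := by
  obtain ⟨N, hN⟩ := (h.eventually_ge_atTop 0).exists_forall_of_atTop
  have hfin : ((Finset.range N).image a : Set ℝ).Finite := Finset.finite_toSet _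
  refine (hfin.bddBelow.union (bddBelow_Ici (a := (0 : ℝ)))).mono ?_
  rintro _ ⟨n, rfl⟩
  rcases lt_or_ge n N with hn | hn
  · left
    exact Finset.mem_coe.2 (Finset.mem_image_of_mem a (Finset.mem_range.2 hn))
  · right
    exact hN n hn

theorem tendsto_add_div_add_zero {u v : ℕ → ℝ} (huv : Tendsto (fun n => u n / v n) atTop (𝓝 0))
    (hv : Tendsto v atTop atTop) (a b : ℝ) :
    Tendsto (fun n => (a + u n) / (b + v n)) atTop (𝓝 0) := by
  have h1 : Tendsto (fun n => (a / v n + u n / v n) / (b / v n + 1)) atTop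
      (𝓝 ((0 + 0) / (0 + 1))) :=
    ((hv.const_div_atTop a).add huv).div ((hv.const_div_atTop b).add_const 1) (by norm_num)
  rw [add_zero, zero_div] at h1
  refine h1.congr' ?_
  filter_upwards [hv.eventually_gt_atTop 0] with n hn
  rw [← add_div, div_add_one hn.ne', div_div_div_cancel_right₀ hn.ne']

/-- A sequence bounded by `M` on `S` whose values at points of `S` at distance at least `N` are
`1`-separated takes few values. -/
theorem card_le_of_separated {a : ℕ → ℝ} {N : ℕ} (hN : 0 < N) {M : ℝ} (hM : 0 ≤ M)
    {S : Finset ℕ} (hS : ∀ j ∈ S, ∀ k ∈ S, j + N ≤ k → 1 ≤ |a k - a j|)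
    (ha : ∀ k ∈ S, |a k| ≤ M) : (S.card : ℝ) ≤ N * (2 * M + 2) := by
  -- Indices congruent mod `N` are at least `N` apart, so `(⌊a k⌋, k % N)` determines `k`.
  have hinj : ∀ j ∈ S, ∀ k ∈ S, j < k → ⌊a j⌋ = ⌊a k⌋ → j % N ≠ k % N := by
    intro j hj k hk hjk hfl hmod
    have hle : j + N ≤ k := by
      have h1 : N ∣ k - j := (Nat.modEq_iff_dvd' hjk.le).1 hmod
      have h2 := Nat.le_of_dvd (by omega) h1
      omega
    have h3 := hS j hj k hk hle
    have h4 := Int.abs_sub_lt_one_of_floor_eq_floor hfl.symm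
    linarith
  have hcard : S.card ≤ (Finset.Icc ⌊-M⌋ ⌊M⌋ ×ˢ Finset.range N).card := by
    refine Finset.card_le_card_of_injOn (fun k => (⌊a k⌋, k % N)) ?_ ?_
    · intro k hk
      have := abs_le.1 (ha k hk)
      simp only [Finset.coe_product, Set.mem_prod, Finset.mem_coe, Finset.mem_Icc,
        Finset.mem_range]
      exact ⟨⟨Int.floor_le_floor this.1, Int.floor_le_floor this.2⟩, Nat.mod_lt _ hN⟩
    · intro j hj k hk hjk
      simp only [Prod.mk.injEq] at hjk
      rcases lt_trichotomy j k with h | h | h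
      · exact absurd hjk.2 (hinj j hj k hk h hjk.1)
      · exact h
      · exact absurd hjk.2.symm (hinj k hk j hj h hjk.1.symm)
  rw [Finset.card_product, Finset.card_range, Int.card_Icc] at hcard
  have h1 : (((⌊M⌋ + 1 - ⌊-M⌋).toNat : ℕ) : ℝ) ≤ 2 * M + 2 := by
    have h2 : ⌊-M⌋ ≤ ⌊M⌋ := Int.floor_le_floor (by linarith)
    have h3 : (((⌊M⌋ + 1 - ⌊-M⌋).toNat : ℤ) : ℝ) = ((⌊M⌋ + 1 - ⌊-M⌋ : ℤ) : ℝ) := by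
      rw [Int.toNat_of_nonneg (by omega)]
    rw [Int.cast_natCast] at h3
    rw [h3]
    push_cast
    linarith [Int.floor_le M, Int.lt_floor_add_one (-M)]
  calc (S.card : ℝ) ≤ ((⌊M⌋ + 1 - ⌊-M⌋).toNat * N : ℕ) := by exact_mod_cast hcard
    _ = N * ((⌊M⌋ + 1 - ⌊-M⌋).toNat : ℕ) := by push_cast; ring
    _ ≤ _ := mul_le_mul_of_nonneg_left h1 N.cast_nonneg

theorem exists_abs_le_of_tendsto_div_zero {u v : ℕ → ℝ}
    (huv : Tendsto (fun n => u n / v n) atTop (𝓝 0)) (hv : Tendsto v atTop atTop)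
    (hv0 : ∀ n, 0 ≤ v n) {ε : ℝ} (hε : 0 < ε) : ∃ C, 0 ≤ C ∧ ∀ k, |u k| ≤ ε * v k + C := by
  have h1 : ∀ᶠ n in atTop, |u n| ≤ ε * v n := by
    filter_upwards [huv.abs.eventually_lt_const (by simpa using hε),
      hv.eventually_gt_atTop 0] with n hn hn'
    rw [abs_div, abs_of_pos hn', div_lt_iff₀ hn'] at hn
    exact hn.le
  obtain ⟨K, hK⟩ := h1.exists_forall_of_atTop
  refine ⟨∑ k ∈ Finset.range K, |u k|, Finset.sum_nonneg fun _ _ => abs_nonneg _, fun k => ?_⟩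
  rcases lt_or_ge k K with hk | hk
  · have h2 := Finset.single_le_sum (f := fun k => |u k|) (fun _ _ => abs_nonneg _)
      (Finset.mem_range.2 hk)
    have h3 := mul_nonneg hε.le (hv0 k)
    linarith
  · have h3 : 0 ≤ ∑ k ∈ Finset.range K, |u k| := Finset.sum_nonneg fun _ _ => abs_nonneg _
    linarith [hK k hk]

/-! ### Pointwise properties of Birkhoff sums -/

section Birkhoff

variable {X : Type*} {T : X → X}

theorem birkhoffSum_nonneg {φ : X → ℝ} (hφ : ∀ x, 0 ≤ φ x) (n : ℕ) (x : X) :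
    0 ≤ birkhoffSum T φ n x :=
  Finset.sum_nonneg fun _ _ => hφ _

theorem birkhoffSum_mono_left {φ : X → ℝ} (hφ : ∀ x, 0 ≤ φ x) (x : X) :
    Monotone fun n => birkhoffSum T φ n x := by
  refine monotone_nat_of_le_succ fun n => ?_
  rw [birkhoffSum_succ]
  linarith [hφ (T^[n] x)]

theorem birkhoffSum_le_birkhoffSum {φ ψ : X → ℝ} (h : ∀ x, φ x ≤ ψ x) (n : ℕ) (x : X) :
    birkhoffSum T φ n x ≤ birkhoffSum T ψ n x :=
  Finset.sum_le_sum fun _ _ => h _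

theorem birkhoffSum_eq_zero {φ : X → ℝ} {x : X} (h : ∀ k, φ (T^[k] x) = 0) (n : ℕ) :
    birkhoffSum T φ n x = 0 :=
  Finset.sum_eq_zero fun _ _ => h _

theorem birkhoffSum_const_mul (c : ℝ) (φ : X → ℝ) (n : ℕ) (x : X) :
    birkhoffSum T (fun y => c * φ y) n x = c * birkhoffSum T φ n x := by
  simp [birkhoffSum, Finset.mul_sum]

/-- The maximum of `0` and the first `n` Birkhoff sums of `g`, defined recursively. -/
noncomputable def maxBirkhoffSum (T : X → X) (g : X → ℝ) : ℕ → X → ℝ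
  | 0, _ => 0
  | n + 1, x => max 0 (g x + maxBirkhoffSum T g n (T x))

theorem maxBirkhoffSum_nonneg (g : X → ℝ) (n : ℕ) (x : X) : 0 ≤ maxBirkhoffSum T g n x := by
  cases n with
  | zero => exact le_rfl
  | succ n => exact le_max_left _ _

theorem maxBirkhoffSum_le_succ (g : X → ℝ) (n : ℕ) :
    ∀ x, maxBirkhoffSum T g n x ≤ maxBirkhoffSum T g (n + 1) x := by
  induction n with
  | zero => exact fun x => maxBirkhoffSum_nonneg g 1 x
  | succ n ih => exact fun x => max_le_max le_rfl (add_le_add le_rfl (ih (T x)))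

theorem birkhoffSum_le_maxBirkhoffSum (g : X → ℝ) (n : ℕ) :
    ∀ x, birkhoffSum T g n x ≤ maxBirkhoffSum T g n x := by
  induction n with
  | zero => exact fun x => le_rfl
  | succ n ih =>
    intro x
    rw [birkhoffSum_succ']
    exact (add_le_add le_rfl (ih (T x))).trans (le_max_right _ _)

/-- Garsia's argument: where the maximum is positive it equals `g` plus the previous maximum at `T
x`, and maxima increase with `n`. -/
theorem maxBirkhoffSum_sub_comp_le (g : X → ℝ) (n : ℕ) (x : X) :
    maxBirkhoffSum T g n x - maxBirkhoffSum T g n (T x) ≤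
      {y | 0 < maxBirkhoffSum T g n y}.indicator g x := by
  by_cases hx : 0 < maxBirkhoffSum T g n x
  · rw [Set.indicator_of_mem (by exact hx)]
    cases n with
    | zero => exact absurd hx (lt_irrefl _)
    | succ n =>
      have h1 : maxBirkhoffSum T g (n + 1) x = g x + maxBirkhoffSum T g n (T x) := by
        refine max_eq_right ?_
        by_contra h
        exact hx.ne' (max_eq_left (not_le.1 h).le)
      linarith [maxBirkhoffSum_le_succ (T := T) g n (T x)]
  · rw [Set.indicator_of_notMem (by exact hx)]
    linarith [maxBirkhoffSum_nonneg (T := T) g n (T x)]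

/-- The points at which `φ_n` diverges but is not bounded below by a multiple of `p_n`. -/
def unboundedRatioSet (T : X → X) (φ p : X → ℝ) : Set X :=
  {x | Tendsto (fun n => birkhoffSum T φ n x) atTop atTop ∧
    ∀ m : ℕ, ∃ᶠ n in atTop, (m : ℝ) * birkhoffSum T φ n x < birkhoffSum T p n x}

theorem tendsto_birkhoffSum_apply_atTop_iff {φ : X → ℝ} (x : X) :
    Tendsto (fun n => birkhoffSum T φ n (T x)) atTop atTop ↔
      Tendsto (fun n => birkhoffSum T φ n x) atTop atTop := by
  rw [← tendsto_add_atTop_iff_nat (f := fun n => birkhoffSum T φ n x) 1]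
  simp only [birkhoffSum_succ']
  refine ⟨fun h => tendsto_atTop_add_const_left _ _ h, fun h => ?_⟩
  simpa using tendsto_atTop_add_const_left _ (-φ x) h

/-- Passing between `x` and `T x` changes each sum by one fixed term; using `m + 1` in place of `m`
leaves a spare copy of `φ_n → ∞` that absorbs it. -/
theorem preimage_unboundedRatioSet {φ p : X → ℝ} (hφ : ∀ x, 0 ≤ φ x) (hp : ∀ x, 0 ≤ p x) :
    T ⁻¹' unboundedRatioSet T φ p = unboundedRatioSet T φ p := by
  ext x
  constructor
  · rintro ⟨h1, h2⟩
    refine ⟨(tendsto_birkhoffSum_apply_atTop_iff x).1 h1, fun m => ?_⟩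
    rw [← frequently_atTop_succ]
    refine ((h2 (m + 1)).and_eventually (h1.eventually_gt_atTop (m * φ x))).mono ?_
    rintro n ⟨h3, h4⟩
    rw [birkhoffSum_succ', birkhoffSum_succ']
    push_cast at h3
    linarith [hp x]
  · rintro ⟨h1, h2⟩
    refine ⟨(tendsto_birkhoffSum_apply_atTop_iff x).2 h1, fun m => ?_⟩
    have h3 := (h2 (m + 1)).and_eventually (h1.eventually_gt_atTop (p x))
    rw [← frequently_atTop_succ] at h3
    refine h3.mono ?_
    rintro n ⟨h3, h4⟩
    rw [birkhoffSum_succ'] at h3 h4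
    rw [birkhoffSum_succ'] at h3
    push_cast at h3
    nlinarith [hφ x, mul_nonneg m.cast_nonneg (hφ x)]

theorem tsum_ofReal_eq_top_of_tendsto {φ : X → ℝ} (hφ : ∀ x, 0 ≤ φ x) {x : X}
    (h : Tendsto (fun n => birkhoffSum T φ n x) atTop atTop) :
    ∑' k : ℕ, ENNReal.ofReal (φ (T^[k] x)) = ∞ := by
  by_contra hne
  have hs := ENNReal.summable_toReal hne
  simp only [ENNReal.toReal_ofReal (hφ _)] at hs
  exact (not_summable_iff_tendsto_nat_atTop_of_nonneg
    (f := fun k => φ (T^[k] x)) fun _ => hφ _).2 h hs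

theorem le_birkhoffSum_div {φ p : X → ℝ} {x : X} {c : ℝ}
    (hp : Tendsto (fun n => birkhoffSum T p n x) atTop atTop)
    (h : ∀ᶠ n in atTop, c * birkhoffSum T p n x ≤ birkhoffSum T φ n x) :
    ∀ᶠ n in atTop, c ≤ birkhoffSum T φ n x / birkhoffSum T p n x := by
  filter_upwards [h, hp.eventually_gt_atTop 0] with n hn hn'
  rwa [le_div_iff₀ hn']

/-- The infimum of the Birkhoff sums of `φ`. -/
noncomputable def infBirkhoffSum (T : X → X) (φ : X → ℝ) (x : X) : ℝ :=
  ⨅ n, birkhoffSum T φ n x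

/-- The cocycle `φ` corrected by the coboundary of `infBirkhoffSum T φ`, truncated at `0`. -/
noncomputable def correctedCocycle (T : X → X) (φ : X → ℝ) (x : X) : ℝ :=
  max 0 (φ x + infBirkhoffSum T φ (T x) - infBirkhoffSum T φ x)

theorem tendsto_birkhoffSum_iterate_atTop {φ : X → ℝ} {x : X}
    (h : Tendsto (fun n => birkhoffSum T φ n x) atTop atTop) (k : ℕ) :
    Tendsto (fun n => birkhoffSum T φ n (T^[k] x)) atTop atTop := by
  induction k with
  | zero => exact h
  | succ k ih =>
    rw [Function.iterate_succ_apply']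
    exact (tendsto_birkhoffSum_apply_atTop_iff _).2 ih

/-- The truncation is inactive: `φ x + infBirkhoffSum T φ (T x)` is the infimum of `φ_n(x)` over `n
≥ 1` only. -/
theorem correctedCocycle_eq {φ : X → ℝ} {x : X}
    (h : Tendsto (fun n => birkhoffSum T φ n x) atTop atTop) :
    correctedCocycle T φ x = φ x + infBirkhoffSum T φ (T x) - infBirkhoffSum T φ x := by
  refine max_eq_right (sub_nonneg.2 ?_)
  rw [← sub_le_iff_le_add']
  refine le_ciInf fun n => ?_
  rw [sub_le_iff_le_add', ← birkhoffSum_succ']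
  exact ciInf_le (bddBelow_range_of_tendsto_atTop h) (n + 1)

theorem birkhoffSum_correctedCocycle {φ : X → ℝ} {x : X}
    (h : Tendsto (fun n => birkhoffSum T φ n x) atTop atTop) (n : ℕ) :
    birkhoffSum T (correctedCocycle T φ) n x =
      birkhoffSum T φ n x + infBirkhoffSum T φ (T^[n] x) - infBirkhoffSum T φ x := by
  induction n with
  | zero => simp
  | succ n ih =>
    rw [birkhoffSum_succ, birkhoffSum_succ, ih,
      correctedCocycle_eq (tendsto_birkhoffSum_iterate_atTop h n), Function.iterate_succ_apply']
    ring

theorem infBirkhoffSum_nonpos {φ : X → ℝ} {x : X}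
    (h : Tendsto (fun n => birkhoffSum T φ n x) atTop atTop) : infBirkhoffSum T φ x ≤ 0 :=
  ciInf_le (bddBelow_range_of_tendsto_atTop h) 0

/-- The points whose Birkhoff sums have modulus at least `1` from time `N` on. -/
def escapeSet (T : X → X) (φ : X → ℝ) (N : ℕ) : Set X :=
  {x | ∀ n, N ≤ n → 1 ≤ |birkhoffSum T φ n x|}

open Classical in
theorem birkhoffSum_indicator_one (A : Set X) (n : ℕ) (x : X) :
    birkhoffSum T (A.indicator fun _ => (1 : ℝ)) n x =
      ((Finset.range n).filter fun k => T^[k] x ∈ A).card := by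
  simp [birkhoffSum, Set.indicator_apply]

/-- The number of visits to an escape set is bounded by the size of the cocycle. -/
theorem birkhoffSum_indicator_escapeSet_le {φ : X → ℝ} {N : ℕ} (hN : 0 < N) {M : ℝ} (hM : 0 ≤ M)
    {n : ℕ} {x : X} (h : ∀ k < n, |birkhoffSum T φ k x| ≤ M) :
    birkhoffSum T ((escapeSet T φ N).indicator fun _ => (1 : ℝ)) n x ≤ N * (2 * M + 2) := by
  classical
  rw [birkhoffSum_indicator_one]
  refine card_le_of_separated (a := fun k => birkhoffSum T φ k x) hN hM ?_ ?_
  · intro j hj k _ hjk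
    have h1 := (Finset.mem_filter.1 hj).2 (k - j) (by omega)
    have h2 := birkhoffSum_add T φ j (k - j) x
    rw [Nat.add_sub_cancel' (by omega)] at h2
    simpa [h2] using h1
  · intro k hk
    exact h k (Finset.mem_range.1 (Finset.mem_filter.1 hk).1)

theorem birkhoffSum_one_eq_natCast (n : ℕ) (x : X) :
    birkhoffSum T (fun _ => (1 : ℝ)) n x = n := by
  simp [birkhoffSum]

/-! ### Maximal inequality and almost-everywhere results -/

variable [MeasurableSpace X] {μ : Measure X}

theorem measurable_birkhoffSum (hT : Measurable T) {φ : X → ℝ} (hφ : Measurable φ) (n : ℕ) :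
    Measurable (birkhoffSum T φ n) :=
  Finset.measurable_fun_sum _ fun k _ => hφ.comp (hT.iterate k)

theorem measurable_maxBirkhoffSum (hT : Measurable T) {g : X → ℝ} (hg : Measurable g) (n : ℕ) :
    Measurable (maxBirkhoffSum T g n) := by
  induction n with
  | zero => exact measurable_const
  | succ n ih => exact measurable_const.max (hg.add (ih.comp hT))

theorem integrable_maxBirkhoffSum (hT : MeasurePreserving T μ μ) {g : X → ℝ}
    (hg : Integrable g μ) (n : ℕ) : Integrable (maxBirkhoffSum T g n) μ := by
  induction n with
  | zero => exact integrable_zero _ _ _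
  | succ n ih =>
    exact (integrable_zero X ℝ μ).sup (hg.add (hT.integrable_comp_of_integrable ih))

/-- **Hopf's maximal inequality**: if almost every point has a positive Birkhoff sum, then the
integral is nonnegative. -/
theorem integral_nonneg_of_ae_exists_birkhoffSum_pos (hT : MeasurePreserving T μ μ) {g : X → ℝ}
    (hgm : Measurable g) (hg : Integrable g μ) (h : ∀ᵐ x ∂μ, ∃ n, 0 < birkhoffSum T g n x) :
    0 ≤ ∫ x, g x ∂μ := by
  set S : ℕ → Set X := fun n => {y | 0 < maxBirkhoffSum T g n y} with hS
  have hSm : ∀ n, MeasurableSet (S n) := fun n =>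
    measurableSet_lt measurable_const (measurable_maxBirkhoffSum hT.measurable hgm n)
  have hmono : Monotone S :=
    monotone_nat_of_le_succ fun n x hx => lt_of_lt_of_le hx (maxBirkhoffSum_le_succ g n x)
  have hpos : ∀ n, 0 ≤ ∫ x in S n, g x ∂μ := by
    intro n
    have hi := integrable_maxBirkhoffSum hT hg n
    have hi' : Integrable (fun x => maxBirkhoffSum T g n (T x)) μ :=
      hT.integrable_comp_of_integrable hi
    have h0 : ∫ x, maxBirkhoffSum T g n (T x) ∂μ = ∫ x, maxBirkhoffSum T g n x ∂μ := by
      have hm := (measurable_maxBirkhoffSum hT.measurable hgm n).aestronglyMeasurable (μ := μ)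
      rw [← hT.map_eq] at hm
      rw [← integral_map hT.measurable.aemeasurable hm, hT.map_eq]
    rw [← integral_indicator (hSm n)]
    calc (0 : ℝ) = ∫ x, (maxBirkhoffSum T g n x - maxBirkhoffSum T g n (T x)) ∂μ := by
          rw [integral_sub hi hi', h0, sub_self]
      _ ≤ _ := integral_mono (hi.sub hi') (hg.indicator (hSm n))
          fun x => maxBirkhoffSum_sub_comp_le g n x
  have hlim := tendsto_setIntegral_of_monotone (μ := μ) (f := g) hSm hmono hg.integrableOn
  have huniv : (⋃ n, S n) =ᵐ[μ] Set.univ := by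
    rw [eventuallyEq_univ]
    filter_upwards [h] with x hx
    obtain ⟨n, hn⟩ := hx
    exact Set.mem_iUnion.2 ⟨n, hn.trans_le (birkhoffSum_le_maxBirkhoffSum g n x)⟩
  rw [setIntegral_congr_set huniv, setIntegral_univ] at hlim
  exact ge_of_tendsto' hlim hpos

/-- By conservativity, an orbit meeting some `{φ > 1/(m+1)}` returns to it infinitely often, so the
series has terms not tending to zero. -/
theorem ae_tendsto_birkhoffSum_atTop (hc : Conservative T μ) {φ : X → ℝ} (hφm : Measurable φ)
    (hφ : ∀ x, 0 ≤ φ x) :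
    ∀ᵐ x ∂μ, (∃ k, φ (T^[k] x) ≠ 0) → Tendsto (fun n => birkhoffSum T φ n x) atTop atTop := by
  have h1 : ∀ᵐ x ∂μ, ∀ m : ℕ, ∀ k, T^[k] x ∈ {y | 1 / ((m : ℝ) + 1) < φ y} →
      ∃ᶠ n in atTop, T^[n] x ∈ {y | 1 / ((m : ℝ) + 1) < φ y} :=
    ae_all_iff.2 fun m => hc.ae_forall_image_mem_imp_frequently_image_mem
      (measurableSet_lt measurable_const hφm).nullMeasurableSet
  filter_upwards [h1] with x hx ⟨k, hk⟩
  obtain ⟨m, hm⟩ := exists_nat_one_div_lt (lt_of_le_of_ne (hφ (T^[k] x)) (Ne.symm hk))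
  have hf := hx m k hm
  refine (not_summable_iff_tendsto_nat_atTop_of_nonneg
    (f := fun k => φ (T^[k] x)) fun _ => hφ _).1 fun hs => ?_
  have h2 := hs.tendsto_atTop_zero.eventually_lt_const (Nat.one_div_pos_of_nat (α := ℝ) (n := m))
  obtain ⟨n, hn, hn'⟩ := (hf.and_eventually h2).exists
  exact lt_asymm hn hn'

theorem measurableSet_unboundedRatioSet (hT : Measurable T) {φ p : X → ℝ} (hφ : Measurable φ)
    (hp : Measurable p) : MeasurableSet (unboundedRatioSet T φ p) := by
  have h : unboundedRatioSet T φ p = {x | Tendsto (fun n => birkhoffSum T φ n x) atTop atTop} ∩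
      ⋂ m : ℕ, ⋂ a : ℕ, ⋃ b : ℕ, ⋃ _ : a ≤ b,
        {x | (m : ℝ) * birkhoffSum T φ b x < birkhoffSum T p b x} := by
    ext x
    simp [unboundedRatioSet, frequently_atTop]
  rw [h]
  refine (measurableSet_tendsto atTop fun n => measurable_birkhoffSum hT hφ n).inter ?_
  refine MeasurableSet.iInter fun m => MeasurableSet.iInter fun a => MeasurableSet.iUnion fun b =>
    MeasurableSet.iUnion fun _ => ?_
  exact measurableSet_lt ((measurable_birkhoffSum hT hφ b).const_mul _)
    (measurable_birkhoffSum hT hp b)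

theorem measure_unboundedRatioSet_eq_zero (hT : MeasurePreserving T μ μ) {φ p : X → ℝ}
    (hφm : Measurable φ) (hφ : ∀ x, 0 ≤ φ x) (hφi : Integrable φ μ) (hpm : Measurable p)
    (hp : ∀ x, 0 ≤ p x) (hpi : Integrable p μ) : ∀ᵐ x ∂μ, x ∉ unboundedRatioSet T φ p := by
  set A := unboundedRatioSet T φ p with hA
  have hAm : MeasurableSet A := measurableSet_unboundedRatioSet hT.measurable hφm hpm
  have hTA : MeasurePreserving T (μ.restrict A) (μ.restrict A) := by
    have := hT.restrict_preimage hAm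
    rwa [preimage_unboundedRatioSet hφ hp] at this
  have hint : ∀ m : ℕ, (m : ℝ) * ∫ x in A, φ x ∂μ ≤ ∫ x in A, p x ∂μ := by
    intro m
    have hmi : Integrable (fun x => (m : ℝ) * φ x) (μ.restrict A) := (hφi.restrict).const_mul _
    have h := integral_nonneg_of_ae_exists_birkhoffSum_pos hTA (g := p - fun x => (m : ℝ) * φ x)
      (hpm.sub (hφm.const_mul _)) (hpi.restrict.sub hmi) ?_
    · rw [integral_sub' hpi.restrict hmi, integral_const_mul] at h
      linarith
    · filter_upwards [ae_restrict_mem hAm] with x hx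
      obtain ⟨n, hn⟩ := (hx.2 m).exists
      refine ⟨n, ?_⟩
      rw [birkhoffSum_sub, birkhoffSum_const_mul]
      linarith
  have hzero : ∫ x in A, φ x ∂μ = 0 := by
    refine le_antisymm (not_lt.1 fun hpos => ?_) (integral_nonneg hφ)
    obtain ⟨m, hm⟩ := exists_nat_gt ((∫ x in A, p x ∂μ) / ∫ x in A, φ x ∂μ)
    rw [div_lt_iff₀ hpos] at hm
    exact absurd (hint m) (not_le.2 hm)
  have hae : ∀ᵐ x ∂μ.restrict A, φ x = 0 :=
    (integral_eq_zero_iff_of_nonneg hφ hφi.restrict).1 hzero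
  have hall : ∀ᵐ x ∂μ.restrict A, ∀ k, φ (T^[k] x) = 0 :=
    ae_all_iff.2 fun k => (hTA.iterate k).quasiMeasurePreserving.ae hae
  rw [ae_restrict_iff' hAm] at hall
  filter_upwards [hall] with x hx hxA
  have h0 : Tendsto (fun n => birkhoffSum T φ n x) atTop atTop := hxA.1
  simp only [birkhoffSum_eq_zero (hx hxA)] at h0
  exact not_tendsto_const_atTop _ _ h0

/-- A nonnegative function whose orbit sum does not vanish has Birkhoff sums at least comparable
with those of any integrable function. -/
theorem ae_exists_const_mul_birkhoffSum_le (hT : MeasurePreserving T μ μ) (hc : Conservative T μ)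
    {φ p : X → ℝ} (hφm : Measurable φ) (hφ : ∀ x, 0 ≤ φ x) (hpm : Measurable p)
    (hp : ∀ x, 0 < p x) (hpi : Integrable p μ) :
    ∀ᵐ x ∂μ, (∃ k, φ (T^[k] x) ≠ 0) →
      ∃ c > 0, ∀ᶠ n in atTop, c * birkhoffSum T p n x ≤ birkhoffSum T φ n x := by
  set ψ : X → ℝ := fun x => min (φ x) (p x) with hψdef
  have hψm : Measurable ψ := hφm.min hpm
  have hψ : ∀ x, 0 ≤ ψ x := fun x => le_min (hφ x) (hp x).le
  have hψi : Integrable ψ μ := hpi.mono' hψm.aestronglyMeasurable <| ae_of_all _ fun x => by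
    rw [Real.norm_of_nonneg (hψ x)]
    exact min_le_right _ _
  filter_upwards [ae_tendsto_birkhoffSum_atTop hc hψm hψ,
    measure_unboundedRatioSet_eq_zero hT hψm hψ hψi hpm (fun x => (hp x).le) hpi]
    with x hx1 hx2 ⟨k, hk⟩
  have ht := hx1 ⟨k, (lt_min (lt_of_le_of_ne (hφ _) hk.symm) (hp _)).ne'⟩
  have : ∃ m : ℕ, ¬ ∃ᶠ n in atTop, (m : ℝ) * birkhoffSum T ψ n x < birkhoffSum T p n x := by
    by_contra! h
    exact hx2 ⟨ht, h⟩
  obtain ⟨m, hm⟩ := this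
  rw [not_frequently] at hm
  -- `m` may be `0`, hence the `m + 1`.
  refine ⟨1 / ((m : ℝ) + 1), by positivity, hm.mono fun n hn => ?_⟩
  have h1 := birkhoffSum_nonneg (T := T) hψ n x
  have h2 : birkhoffSum T ψ n x ≤ birkhoffSum T φ n x :=
    birkhoffSum_le_birkhoffSum (fun y => min_le_left _ _) n x
  rw [one_div, inv_mul_le_iff₀ (by positivity)]
  nlinarith [not_lt.1 hn, m.cast_nonneg (α := ℝ)]

theorem ae_tendsto_birkhoffSum_atTop_of_pos (hc : Conservative T μ) {p : X → ℝ}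
    (hpm : Measurable p) (hp : ∀ x, 0 < p x) :
    ∀ᵐ x ∂μ, Tendsto (fun n => birkhoffSum T p n x) atTop atTop := by
  filter_upwards [ae_tendsto_birkhoffSum_atTop hc hpm fun x => (hp x).le] with x hx
  exact hx ⟨0, (hp _).ne'⟩

theorem ae_extLiminf_pos_of_nonneg (hT : MeasurePreserving T μ μ) (hc : Conservative T μ)
    {φ p : X → ℝ} (hφm : Measurable φ) (hφ : ∀ x, 0 ≤ φ x) (hpm : Measurable p)
    (hp : ∀ x, 0 < p x) (hpi : Integrable p μ) :
    ∀ᵐ x ∂μ, (∃ k, φ (T^[k] x) ≠ 0) →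
      0 < extLiminf (fun n => birkhoffSum T φ n x / birkhoffSum T p n x) := by
  filter_upwards [ae_exists_const_mul_birkhoffSum_le hT hc hφm hφ hpm hp hpi,
    ae_tendsto_birkhoffSum_atTop_of_pos hc hpm hp] with x h1 h2 hk
  obtain ⟨c, hc0, hc1⟩ := h1 hk
  exact extLiminf_pos hc0 (le_birkhoffSum_div h2 hc1)

theorem measurable_infBirkhoffSum (hT : Measurable T) {φ : X → ℝ} (hφ : Measurable φ) :
    Measurable (infBirkhoffSum T φ) :=
  Measurable.iInf fun n => measurable_birkhoffSum hT hφ n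

theorem measurable_correctedCocycle (hT : Measurable T) {φ : X → ℝ} (hφ : Measurable φ) :
    Measurable (correctedCocycle T φ) :=
  measurable_const.max ((hφ.add ((measurable_infBirkhoffSum hT hφ).comp hT)).sub
    (measurable_infBirkhoffSum hT hφ))

theorem ae_extLiminf_pos_of_tendsto_atTop (hT : MeasurePreserving T μ μ) (hc : Conservative T μ)
    {φ p : X → ℝ} (hφm : Measurable φ) (hpm : Measurable p) (hp : ∀ x, 0 < p x)
    (hpi : Integrable p μ) :
    ∀ᵐ x ∂μ, Tendsto (fun n => birkhoffSum T φ n x) atTop atTop →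
      0 < extLiminf (fun n => birkhoffSum T φ n x / birkhoffSum T p n x) := by
  have hrec : ∀ᵐ x ∂μ, ∀ K : ℕ, ∀ k, T^[k] x ∈ {y | -(K : ℝ) ≤ infBirkhoffSum T φ y} →
      ∃ᶠ n in atTop, T^[n] x ∈ {y | -(K : ℝ) ≤ infBirkhoffSum T φ y} :=
    ae_all_iff.2 fun K => hc.ae_forall_image_mem_imp_frequently_image_mem (measurableSet_le
      measurable_const (measurable_infBirkhoffSum hT.measurable hφm)).nullMeasurableSet
  filter_upwards [hrec, ae_tendsto_birkhoffSum_atTop_of_pos hc hpm hp,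
    ae_exists_const_mul_birkhoffSum_le hT hc (measurable_correctedCocycle hT.measurable hφm)
      (fun x => le_max_left _ _) hpm hp hpi] with x hx1 hx2 hx3 h
  by_cases hk : ∃ k, correctedCocycle T φ (T^[k] x) ≠ 0
  · obtain ⟨c, hc0, hc1⟩ := hx3 hk
    -- Half of `c * p_n` is given up to absorb the constant `-infBirkhoffSum T φ x`.
    refine extLiminf_pos (half_pos hc0) (le_birkhoffSum_div hx2 ?_)
    filter_upwards [hc1, hx2.eventually_ge_atTop (-infBirkhoffSum T φ x / (c / 2))] with n h1 h2
    rw [div_le_iff₀ (half_pos hc0)] at h2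
    rw [birkhoffSum_correctedCocycle h] at h1
    linarith [infBirkhoffSum_nonpos (tendsto_birkhoffSum_iterate_atTop h n)]
  -- Here `φ_n(x)` is the infimum at `x` minus that at `T^[n] x`, hence bounded along the returns to
  -- `{-K ≤ infBirkhoffSum T φ}`: divergence is impossible.
  · push Not at hk
    obtain ⟨K, hK⟩ := exists_nat_ge (-infBirkhoffSum T φ x)
    have hf := hx1 K 0 (neg_le.1 hK)
    obtain ⟨n, hn, hn'⟩ :=
      (hf.and_eventually (h.eventually_gt_atTop (infBirkhoffSum T φ x + K))).exists
    have h0 := birkhoffSum_correctedCocycle h n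
    rw [birkhoffSum_eq_zero hk] at h0
    have hn2 : -(K : ℝ) ≤ infBirkhoffSum T φ (T^[n] x) := hn
    linarith

theorem preimage_zeroRatioSet_ae_eq {φ p : X → ℝ}
    (hp : ∀ᵐ x ∂μ, Tendsto (fun n => birkhoffSum T p n x) atTop atTop) :
    T ⁻¹' zeroRatioSet T φ p =ᵐ[μ] zeroRatioSet T φ p := by
  rw [eventuallyEq_set]
  filter_upwards [hp] with x hx
  have hx' := (tendsto_birkhoffSum_apply_atTop_iff x).2 hx
  change Tendsto _ _ _ ↔ Tendsto _ _ _
  rw [← tendsto_add_atTop_iff_nat (f := fun n => birkhoffSum T φ n x / birkhoffSum T p n x) 1]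
  constructor
  · intro h
    simpa only [birkhoffSum_succ'] using tendsto_add_div_add_zero h hx' (φ x) (p x)
  · intro h
    have h2 := tendsto_add_div_add_zero h ((tendsto_add_atTop_iff_nat 1).2 hx) (-φ x) (-p x)
    simpa only [birkhoffSum_succ', neg_add_cancel_left] using h2

theorem measurableSet_escapeSet (hT : Measurable T) {φ : X → ℝ} (hφ : Measurable φ) (N : ℕ) :
    MeasurableSet (escapeSet T φ N) := by
  have h : escapeSet T φ N = ⋂ n : ℕ, ⋂ _ : N ≤ n, {x | 1 ≤ |birkhoffSum T φ n x|} := by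
    ext x
    simp [escapeSet]
  rw [h]
  exact MeasurableSet.iInter fun n => MeasurableSet.iInter fun _ =>
    measurableSet_le measurable_const (measurable_birkhoffSum hT hφ n).abs

theorem cocycleRecurrentOn_zeroRatioSet (hT : MeasurePreserving T μ μ) (hc : Conservative T μ)
    {φ p : X → ℝ} (hφm : Measurable φ) (hpm : Measurable p) (hp : ∀ x, 0 < p x)
    (hpi : Integrable p μ) : CocycleRecurrentOn T φ μ (zeroRatioSet T φ p) := by
  have hvis : ∀ᵐ x ∂μ, ∀ N : ℕ,
      (∃ k, (escapeSet T φ N).indicator (fun _ => (1 : ℝ)) (T^[k] x) ≠ 0) →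
      ∃ c > 0, ∀ᶠ n in atTop, c * birkhoffSum T p n x ≤
        birkhoffSum T ((escapeSet T φ N).indicator fun _ => (1 : ℝ)) n x :=
    ae_all_iff.2 fun N => ae_exists_const_mul_birkhoffSum_le hT hc
      (measurable_const.indicator (measurableSet_escapeSet hT.measurable hφm N))
      (Set.indicator_nonneg fun _ _ => zero_le_one) hpm hp hpi
  filter_upwards [hvis, ae_tendsto_birkhoffSum_atTop_of_pos hc hpm hp] with x hx hpx hz
  by_contra hinf
  have hev : ∀ᶠ n in atTop, (1 : ℝ≥0∞) < ‖birkhoffSum T φ n x‖ₑ :=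
    eventually_lt_of_lt_liminf (lt_of_lt_of_le ENNReal.one_lt_top (not_lt.1 hinf))
  obtain ⟨N, hN⟩ := hev.exists_forall_of_atTop
  have hmem : x ∈ escapeSet T φ (N + 1) := by
    intro n hn
    have h1 := hN n (by omega)
    rw [Real.enorm_eq_ofReal_abs, ← ENNReal.ofReal_one] at h1
    exact ((ENNReal.ofReal_lt_ofReal_iff_of_nonneg zero_le_one).1 h1).le
  obtain ⟨c, hc0, hev2⟩ := hx (N + 1) ⟨0, by simp [hmem]⟩
  have hN0 : (0 : ℝ) < (N + 1 : ℕ) := by positivity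
  have hp0 : ∀ y, 0 ≤ p y := fun y => (hp y).le
  -- With this `ε` the visit bound `(N + 1) * (2M + 2)`, `M = ε * p_n + C`, grows only like `(c / 2)
  -- * p_n`.
  obtain ⟨C, hC0, hC⟩ := exists_abs_le_of_tendsto_div_zero (ε := c / (4 * (N + 1 : ℕ))) hz hpx
    (fun n => birkhoffSum_nonneg hp0 n x) (by positivity)
  obtain ⟨n, hn1, hn2⟩ := (hev2.and
    (hpx.eventually_gt_atTop ((N + 1 : ℕ) * (2 * C + 2) / (c / 2)))).exists
  have hpn : 0 ≤ birkhoffSum T p n x := birkhoffSum_nonneg hp0 n x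
  have hle := birkhoffSum_indicator_escapeSet_le (T := T) (φ := φ) (N := N + 1) (x := x) (n := n)
    N.succ_pos (M := c / (4 * (N + 1 : ℕ)) * birkhoffSum T p n x + C) (by positivity) ?_
  · rw [div_lt_iff₀ (half_pos hc0)] at hn2
    have h4 : ((N + 1 : ℕ) : ℝ) * (2 * (c / (4 * (N + 1 : ℕ)) * birkhoffSum T p n x + C) + 2) =
        birkhoffSum T p n x * (c / 2) + (N + 1 : ℕ) * (2 * C + 2) := by
      field_simp
      ring
    rw [h4] at hle
    linarith
  · intro k hk
    refine (hC k).trans ?_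
    gcongr
    exact birkhoffSum_mono_left hp0 x hk.le

end Birkhoff

theorem mainTheorem10 {X : Type*} [MeasurableSpace X] (T : X → X) (μ : Measure X)
    (hT : MeasurePreserving T μ μ) :
    (SigmaFinite μ → Conservative T μ →
      ∀ p : X → ℝ, Measurable p → (∀ x, 0 < p x) → Integrable p μ →
        (∀ φ : X → ℝ, Measurable φ → (∀ x, 0 ≤ φ x) →
          (∀ᵐ x ∂μ, ∑' k : ℕ, ENNReal.ofReal (φ (T^[k] x)) = 0 ∨
            ∑' k : ℕ, ENNReal.ofReal (φ (T^[k] x)) = ∞) ∧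
          (∀ᵐ x ∂μ, ∑' k : ℕ, ENNReal.ofReal (φ (T^[k] x)) ≠ 0 →
            0 < extLiminf (fun n => birkhoffSum T φ n x / birkhoffSum T p n x))) ∧
        (∀ φ : X → ℝ, Measurable φ →
          (∀ᵐ x ∂μ, Tendsto (fun n : ℕ => birkhoffSum T φ n x) atTop atTop →
            0 < extLiminf (fun n => birkhoffSum T φ n x / birkhoffSum T p n x)) ∧
          T ⁻¹' (zeroRatioSet T φ p) =ᵐ[μ] zeroRatioSet T φ p ∧
          CocycleRecurrentOn T φ μ (zeroRatioSet T φ p))) ∧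
    (IsProbabilityMeasure μ →
      ∀ φ : X → ℝ, Measurable φ →
        (∀ᵐ x ∂μ, Tendsto (fun n : ℕ => birkhoffSum T φ n x) atTop atTop →
          0 < extLiminf (fun n => birkhoffSum T φ n x / (n : ℝ))) ∧
        T ⁻¹' (zeroMeanSet T φ) =ᵐ[μ] zeroMeanSet T φ ∧
        CocycleRecurrentOn T φ μ (zeroMeanSet T φ)) := by
  have hmain : Conservative T μ → ∀ p : X → ℝ, Measurable p → (∀ x, 0 < p x) → Integrable p μ →
      ∀ φ : X → ℝ, Measurable φ →
        (∀ᵐ x ∂μ, Tendsto (fun n : ℕ => birkhoffSum T φ n x) atTop atTop →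
          0 < extLiminf (fun n => birkhoffSum T φ n x / birkhoffSum T p n x)) ∧
        T ⁻¹' (zeroRatioSet T φ p) =ᵐ[μ] zeroRatioSet T φ p ∧
        CocycleRecurrentOn T φ μ (zeroRatioSet T φ p) :=
    fun hc p hpm hp hpi φ hφ =>
      ⟨ae_extLiminf_pos_of_tendsto_atTop hT hc hφ hpm hp hpi,
        preimage_zeroRatioSet_ae_eq (ae_tendsto_birkhoffSum_atTop_of_pos hc hpm hp),
        cocycleRecurrentOn_zeroRatioSet hT hc hφ hpm hp hpi⟩
  refine ⟨fun _ hc p hpm hp hpi => ⟨fun φ hφm hφ => ⟨?_, ?_⟩, hmain hc p hpm hp hpi⟩, ?_⟩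
  · filter_upwards [ae_tendsto_birkhoffSum_atTop hc hφm hφ] with x hx
    by_cases hk : ∃ k, φ (T^[k] x) ≠ 0
    · exact Or.inr (tsum_ofReal_eq_top_of_tendsto hφ (hx hk))
    · push Not at hk
      exact Or.inl (by simp [hk])
  · filter_upwards [ae_extLiminf_pos_of_nonneg hT hc hφm hφ hpm hp hpi] with x hx hsum
    refine hx ?_
    by_contra! hk
    exact hsum (by simp [hk])
  · intro _ φ hφm
    -- Poincaré recurrence gives conservativity, and `p = 1` has `p_n = n`.
    have h := hmain hT.conservative (fun _ => 1) measurable_const (fun _ => one_pos)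
      (integrable_const 1) φ hφm
    simpa only [zeroRatioSet, zeroMeanSet, birkhoffSum_one_eq_natCast] using h
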